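/- An \emph{index} is a finite (possibly empty) tuple $\boldsymbol{k}=(k_1,\dots,k_r)$ of positive integers; put $\mathrm{dep}(\boldsymbol{k})=r$, and let $\varnothing$ be the empty index. Let $$\mathcal{A}=\Bigl(\prod_{p}\mathbb{Z}/p\mathbb{Z}\Bigr)\Big/\Bigl(\bigoplus_{p}\mathbb{Z}/p\mathbb{Z}\Bigr),$$ where $p$ runs over all primes; this is a $\mathbb{Q}$-algebra. The finite multiple zeta value of $\boldsymbol{k}$ is $$\zeta_{\mathcal{A}}(\boldsymbol{k})=\bigl(\zeta_{<p}(\boldsymbol{k})\bmod p\bigr)_p\in\mathcal{A},\qquad \zeta_{<N}(\boldsymbol{k})=\sum_{0<n_1<\cdots<n_r<N}\frac{1}{n_1^{k_1}\cdots n_r^{k_r}}\in\mathbb{Q}.$$ Let $\mathcal{R}$ be the space of formal $\mathbb{Q}$-linear combinations of indices, and extend $\zeta_{\mathcal{A}}$ $\mathbb{Q}$-linearly to $\mathcal{R}$. Let $\ast$ be the harmonic product on $\mathcal{R}$: it is $\mathbb{Q}$-bilinear, $\varnothing\ast\boldsymbol{k}=\boldsymbol{k}\ast\varnothing=\boldsymbol{k}$,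 and for indices $\boldsymbol{k}=(\boldsymbol{k}_-,a)$ and $\boldsymbol{l}=(\boldsymbol{l}_-,b)$ with last entries $a,b$, $$\boldsymbol{k}\ast\boldsymbol{l}=(\boldsymbol{k}_-\ast\boldsymbol{l},\,a)+(\boldsymbol{k}\ast\boldsymbol{l}_-,\,b)+(\boldsymbol{k}_-\ast\boldsymbol{l}_-,\,a+b).$$ Define a $\mathbb{Q}$-bilinear map $\underline{\ast}\colon\mathcal{R}\times\mathcal{R}\to\mathcal{R}$ by $$\boldsymbol{k}\mathbin{\underline{\ast}}\boldsymbol{l}=(\boldsymbol{k}_-\ast\boldsymbol{l},\,a)+(\boldsymbol{k}_-\ast\boldsymbol{l}_-,\,a+b)$$ for such nonempty $\boldsymbol{k},\boldsymbol{l}$, with the conventions $\boldsymbol{k}\mathbin{\underline{\ast}}\varnothing=\boldsymbol{k}$ for every index $\boldsymbol{k}$ and $\varnothing\mathbin{\underline{\ast}}\boldsymbol{l}=0$ for nonempty $\boldsymbol{l}$. For indices $\boldsymbol{h},\boldsymbol{k}$ write $\boldsymbol{h}\preceq\boldsymbol{k}$ if $\boldsymbol{h}$ is obtained from $\boldsymbol{k}=(k_1,\dots,k_r)$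 by replacing some (possibly none) of the commas by plus signs, and put $\boldsymbol{k}^{\star}=\sum_{\boldsymbol{h}\preceq\boldsymbol{k}}\boldsymbol{h}\in\mathcal{R}$. Let $\{1\}^m$ denote $m$ repetitions of $1$. For $\boldsymbol{l}=(l_1,\dots,l_r)\in\mathbb{Z}_{\ge 0}^r$ and an index $\boldsymbol{k}=(k_1,\dots,k_r)$ put $\mathrm{wt}(\boldsymbol{l})=l_1+\cdots+l_r$, $$\boldsymbol{l}\oplus\boldsymbol{k}=(l_1+k_1,\dots,l_r+k_r),\qquad \boldsymbol{l}\oslash\boldsymbol{k}=(l_1+1,\{1\}^{k_1-1},\dots,l_r+1,\{1\}^{k_r-1}).$$ \textbf{Theorem.} For every index $\boldsymbol{k}$ and every integer $m\ge 0$, the following identity holds in $\mathcal{A}$: $$\zeta_{\mathcal{A}}\bigl(\boldsymbol{k}\mathbin{\underline{\ast}}(\{1\}^m)^{\star}\bigr)=(-1)^{\mathrm{dep}(\boldsymbol{k})}\sum_{\substack{\boldsymbol{l}\in\mathbb{Z}_{\ge 0}^{\mathrm{dep}(\boldsymbol{k})}\\ \mathrm{wt}(\boldsymbol{l})=m}}\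 \sum_{\boldsymbol{l}\oplus\boldsymbol{k}\preceq\boldsymbol{h}\preceq\boldsymbol{l}\oslash\boldsymbol{k}}\zeta_{\mathcal{A}}(\boldsymbol{h}).$$ In particular, for $m=0$ the left-hand side is $\zeta_{\mathcal{A}}(\boldsymbol{k})$. -/

import Mathlib

noncomputable section

namespace FMZV

/-- An index is a finite tuple of positive integers; its depth is its length. The empty tuple is
the empty index. -/
abbrev Index : Type := List ℕ+

/-- `ζ_{<N}(k₁, …, k_r)`, the sum of `1 / (n₁ ^ k₁ ⋯ n_r ^ k_r)` over `0 < n₁ < ⋯ < n_r < N`. -/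
def zetaLT (N : ℕ) (k : Index) : ℚ :=
  ∑ n ∈ Fintype.piFinset (fun _ : Fin k.length => Finset.Ioo 0 N) with
      (∀ i j : Fin k.length, i < j → n i < n j),
    ∏ i : Fin k.length, 1 / (n i : ℚ) ^ (k.get i : ℕ)

/-! ### The ring `𝒜` -/

/-- The families with finitely many nonzero entries, i.e. the direct sum of all `ℤ/p`, as an ideal
of the product of all `ℤ/p`. -/
def sumIdeal : Ideal (∀ p : Nat.Primes, ZMod p) where
  carrier := {f | {p | f p ≠ 0}.Finite}
  zero_mem' := by simp
  add_mem' {f g} hf hg := by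
    refine (Set.Finite.union hf hg).subset fun p hp => ?_
    by_contra h
    simp only [Set.mem_union, Set.mem_ofPred_eq, not_or, not_not] at h
    exact hp (by simp [h.1, h.2])
  smul_mem' c f hf := by
    refine Set.Finite.subset hf fun p hp h => hp ?_
    simp [h]

/-- `𝒜 = (∏_p ℤ/p) / (⨁_p ℤ/p)`. -/
abbrev RingA : Type := (∀ p : Nat.Primes, ZMod p) ⧸ sumIdeal

instance (p : Nat.Primes) : Fact (p : ℕ).Prime := ⟨p.2⟩

theorem isUnit_intCast {n : ℤ} (hn : n ≠ 0) : IsUnit (n : RingA) := by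
  refine IsUnit.of_mul_eq_one
    (Ideal.Quotient.mk sumIdeal fun p : Nat.Primes => ((n : ZMod p))⁻¹) ?_
  rw [← map_intCast (Ideal.Quotient.mk sumIdeal), ← map_mul,
    ← map_one (Ideal.Quotient.mk sumIdeal), Ideal.Quotient.eq]
  have hfin : {p : Nat.Primes | (p : ℕ) ∣ n.natAbs}.Finite := by
    refine Set.Finite.of_finite_image (f := fun p : Nat.Primes => (p : ℕ)) ?_
      (Subtype.val_injective.injOn)
    refine (Set.finite_Iic n.natAbs).subset ?_
    rintro _ ⟨p, hp, rfl⟩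
    exact Nat.le_of_dvd (Int.natAbs_pos.mpr hn) hp
  refine hfin.subset fun p hp => ?_
  by_contra h
  apply hp
  have h' : (n : ZMod p) ≠ 0 := by
    rw [Ne, ZMod.intCast_zmod_eq_zero_iff_dvd]
    exact fun hd => h (Int.natCast_dvd.mp hd)
  simp [mul_inv_cancel₀ h']

/-- `𝒜` is a `ℚ`-algebra, in the only possible way: nonzero integers are invertible in it. -/
instance : Algebra ℚ RingA :=
  (IsLocalization.lift (M := nonZeroDivisors ℤ) (S := ℚ) (g := Int.castRingHom RingA)
    (fun n => isUnit_intCast (nonZeroDivisors.ne_zero n.2))).toAlgebra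

/-- The finite multiple zeta value `ζ_𝒜(k) = (ζ_{<p}(k) mod p)_p`. The coercion of a rational
number to `ZMod p` is its numerator divided by its denominator, and the denominator of `ζ_{<p}(k)`
is prime to `p`. -/
def zetaA (k : Index) : RingA :=
  Ideal.Quotient.mk sumIdeal fun p : Nat.Primes => ((zetaLT p k : ℚ) : ZMod p)

/-! ### Formal sums of indices -/

/-- `ℛ`, the space of formal `ℚ`-linear combinations of indices. -/
abbrev IndexSpace : Type := Index →₀ ℚ

/-- An index as an element of `ℛ`. -/
def single (k : Index) : IndexSpace := Finsupp.single k 1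

/-- The `ℚ`-linear extension of `ζ_𝒜` to `ℛ`. -/
def zetaALin : IndexSpace →ₗ[ℚ] RingA := Finsupp.linearCombination ℚ zetaA

/-- The `ℚ`-linear map `h ↦ (h, a)`, which appends the entry `a`. -/
def snoc (a : ℕ+) : IndexSpace →ₗ[ℚ] IndexSpace :=
  Finsupp.lmapDomain ℚ ℚ fun h : Index => h ++ [a]

/-- The harmonic product of two indices that are given with their entries in reverse order. -/
def harmonicAux : List ℕ+ → List ℕ+ → IndexSpace
  | [], l => single l.reverse
  | a :: k, [] => single (a :: k).reverse
  | a :: k, b :: l =>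
      snoc a (harmonicAux k (b :: l)) + snoc b (harmonicAux (a :: k) l) +
        snoc (a + b) (harmonicAux k l)
  termination_by k l => k.length + l.length

/-- The harmonic (stuffle) product `k ∗ l` of two indices. It is determined by
`harmonic_nil_left`, `harmonic_nil_right` and `harmonic_snoc_snoc`. -/
def harmonic (k l : Index) : IndexSpace := harmonicAux k.reverse l.reverse

theorem harmonic_nil_left (l : Index) : harmonic [] l = single l := by
  simp [harmonic, harmonicAux]

theorem harmonic_nil_right (k : Index) : harmonic k [] = single k := by
  unfold harmonic
  rcases List.eq_nil_or_concat k with rfl | ⟨t, a, rfl⟩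
  · simp [harmonicAux]
  · simp [harmonicAux]

theorem harmonic_snoc_snoc (k l : Index) (a b : ℕ+) :
    harmonic (k ++ [a]) (l ++ [b]) =
      snoc a (harmonic k (l ++ [b])) + snoc b (harmonic (k ++ [a]) l) +
        snoc (a + b) (harmonic k l) := by
  simp [harmonic, harmonicAux]

/-- The product `k ∗̲ l = ((k₋ ∗ l), a) + ((k₋ ∗ l₋), a + b)` of the indices `k = (k₋, a)` and
`l = (l₋, b)`, with the conventions `k ∗̲ ∅ = k` for every `k`, and `∅ ∗̲ l = 0` for nonempty
`l`. -/
def underIndex (k l : Index) : IndexSpace :=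
  if hl : l = [] then single k
  else if hk : k = [] then 0
  else
    snoc (k.getLast hk) (harmonic k.dropLast l) +
      snoc (k.getLast hk + l.getLast hl) (harmonic k.dropLast l.dropLast)

/-- The `ℚ`-bilinear product `∗̲` on `ℛ`. -/
def under : IndexSpace →ₗ[ℚ] IndexSpace →ₗ[ℚ] IndexSpace :=
  Finsupp.linearCombination ℚ fun k => Finsupp.linearCombination ℚ fun l => underIndex k l

/-! ### Merging entries -/

/-- `Coarser h k` is the relation `h ⪯ k`: `h` arises from `k` by replacing some commas by plus
signs. Reading `k` from the left, the first comma is either kept or replaced by a plus sign. -/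
inductive Coarser : Index → Index → Prop
  | nil : Coarser [] []
  | keep (a : ℕ+) {h k : Index} : Coarser h k → Coarser (a :: h) (a :: k)
  | plus (a b : ℕ+) {h k : Index} : Coarser h ((a + b) :: k) → Coarser h (a :: b :: k)

/-- The finite set of all `h ⪯ k`, see `mem_coarsenings`. -/
def coarsenings : Index → Finset Index
  | [] => {[]}
  | [a] => {[a]}
  | a :: b :: k => (coarsenings (b :: k)).image (a :: ·) ∪ coarsenings ((a + b) :: k)
  termination_by k => k.length

theorem mem_coarsenings {h k : Index} : h ∈ coarsenings k ↔ Coarser h k := by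
  constructor
  · intro H
    induction k using coarsenings.induct generalizing h with
    | case1 =>
      simp only [coarsenings, Finset.mem_singleton] at H
      exact H ▸ Coarser.nil
    | case2 a =>
      simp only [coarsenings, Finset.mem_singleton] at H
      exact H ▸ Coarser.keep a Coarser.nil
    | case3 a b k ih1 ih2 =>
      rw [coarsenings, Finset.mem_union, Finset.mem_image] at H
      rcases H with ⟨h', H, rfl⟩ | H
      · exact Coarser.keep a (ih1 H)
      · exact Coarser.plus a b (ih2 H)
  · intro H
    induction H with
    | nil => simp [coarsenings]
    | @keep a h k H ih =>
      rcases k with _ | ⟨b, k⟩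
      · simp only [coarsenings, Finset.mem_singleton] at ih ⊢
        rw [ih]
      · rw [coarsenings, Finset.mem_union, Finset.mem_image]
        exact Or.inl ⟨h, ih, rfl⟩
    | @plus a b h k H ih =>
      rw [coarsenings, Finset.mem_union]
      exact Or.inr ih

instance (h k : Index) : Decidable (Coarser h k) := decidable_of_iff _ mem_coarsenings

/-- `k^⋆`, the formal sum of all `h ⪯ k`. -/
def star (k : Index) : IndexSpace := ∑ h ∈ coarsenings k, single h

/-- `l ⊕ k = (l₁ + k₁, …, l_r + k_r)`. -/
def oplus (k : Index) (l : Fin k.length → ℕ) : Index :=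
  List.ofFn fun i => ⟨l i + (k.get i : ℕ), Nat.add_pos_right _ (k.get i).pos⟩

/-- `l ⊘ k = (l₁ + 1, {1}^{k₁ - 1}, …, l_r + 1, {1}^{k_r - 1})`. -/
def oslash (k : Index) (l : Fin k.length → ℕ) : Index :=
  (List.ofFn fun i => (l i).succPNat :: List.replicate ((k.get i : ℕ) - 1) (1 : ℕ+)).flatten

/-- The finite set of all `h` with `l ⊕ k ⪯ h ⪯ l ⊘ k`. -/
def between (k : Index) (l : Fin k.length → ℕ) : Finset Index :=
  {h ∈ coarsenings (oslash k l) | Coarser (oplus k l) h}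

end FMZV

end

/-! The proof is a connected sum with a formal parameter. Where `w n` is 1/n and `u n` is 1/(x - n)
for 0 < n < N, the kernel C(n, m) = m(m-1)⋯(m-n+1) / ((x-1)⋯(x-n)) satisfies C(n, m) - C(n, m-1) =
(n/m) C(n, m) and C(n, m)/m = (C(n-1, m-1) - C(n, m-1)) / (x - m). Pair C with the differences of a
sequence s in the variable m. By Abel summation and the first relation, a factor 1/n outside the
pairing becomes a weak tail sum of s (`mul_pairing_eq_pairing_tailSum`). By the second relation and
telescoping, a strict sum over n with one factor 1/n becomes a strict sum of s with weight 1/(x - m)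
(`sum_mul_pairing`). Moving all of k across in this way gives `nested_connector`.

Now take N = p over the power series ring of ℤ/p, with x = X. Since p - 1 = -1, C(n, p-1) is the
product of 1/(1 - X/j) over j ≤ n, and its coefficient of X^m is the star sum of {1}^m up to n
(`coeff_connector`). With n the largest variable of k, this is the left-hand side
(`zetaLTLin_underIndex`). On the other side 1/(X - n) = -∑ X^i / n^(i+1), which produces the sign
and the exponents l; splitting the weak inequalities inside each block into < and = produces exactly
the h between l ⊕ k and l ⊘ k (`coeff_blockNested`). The identity thus holds at every prime. -/

namespace FMZV

/-! ### Nested sums and tail sums -/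

section Nested

variable {R : Type*} [CommRing R]

/-- The sum of `w n₁ ^ k₁ ⋯ w n_r ^ k_r * f n_r` over `a < n₁ < ⋯ < n_r < N`. -/
def nested (w : ℕ → R) (N : ℕ) (f : ℕ → R) : Index → ℕ → R
  | [], a => f a
  | c :: k, a => ∑ n ∈ Finset.Ioo a N, w n ^ (c : ℕ) * nested w N f k n

/-- The weighted tail sum `∑_{a ≤ n < N} w n * f n`. -/
def tailSum (w : ℕ → R) (N : ℕ) (f : ℕ → R) (a : ℕ) : R :=
  ∑ n ∈ Finset.Ico a N, w n * f n

/-- The sum of `∏ i, u n_{i,1} * w n_{i,2} ⋯ w n_{i,k_i}`, times `f` of the last variable, over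
`a < n_{1,1} ≤ ⋯ ≤ n_{1,k₁} < n_{2,1} ≤ ⋯ < N`. -/
def blockNested (w u : ℕ → R) (N : ℕ) (f : ℕ → R) : Index → ℕ → R
  | [], a => f a
  | c :: k, a => ∑ n ∈ Finset.Ioo a N,
      u n * (tailSum w N)^[(c : ℕ) - 1] (blockNested w u N f k) n

theorem nested_append (w : ℕ → R) (N : ℕ) (f : ℕ → R) (h k : Index) :
    nested w N f (h ++ k) = nested w N (nested w N f k) h := by
  induction h with
  | nil => rfl
  | cons c h ih =>
    funext a
    simp only [List.cons_append, nested, ih]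

theorem nested_sum {ι : Type*} (s : Finset ι) (w : ℕ → R) (N : ℕ) (f : ι → ℕ → R) (k : Index)
    (a : ℕ) :
    nested w N (fun n => ∑ i ∈ s, f i n) k a = ∑ i ∈ s, nested w N (f i) k a := by
  induction k generalizing a with
  | nil => rfl
  | cons c k ih =>
    simp only [nested, ih, Finset.mul_sum]
    exact Finset.sum_comm

theorem nested_congr {w : ℕ → R} {N : ℕ} {f g : ℕ → R} (hfg : ∀ n < N, f n = g n) (k : Index)
    {a : ℕ} (ha : a < N) : nested w N f k a = nested w N g k a := by
  induction k generalizing a with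
  | nil => exact hfg a ha
  | cons c k ih =>
    refine Finset.sum_congr rfl fun n hn => ?_
    rw [ih (Finset.mem_Ioo.mp hn).2]

/-- Exchanging the order of summation puts the largest variable outermost. `nested` unfolds from the
first entry, whereas the harmonic products recurse on the last one. -/
theorem nested_concat (w : ℕ → R) (N : ℕ) (f : ℕ → R) (k : Index) (c : ℕ+) (a : ℕ) :
    nested w N f (k ++ [c]) a =
      ∑ n ∈ Finset.Ioo a N, w n ^ (c : ℕ) * f n * nested w n 1 k a := by
  induction k generalizing a with
  | nil => simp [nested]
  | cons d k ih =>
    simp only [List.cons_append, nested, ih, Finset.mul_sum]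
    rw [Finset.sum_comm' (t' := Finset.Ioo a N) (s' := fun n => Finset.Ioo a n)]
    · refine Finset.sum_congr rfl fun n _ => Finset.sum_congr rfl fun m _ => by ring
    · intro x y
      simp only [Finset.mem_Ioo]
      omega

theorem tailSum_of_lt (w : ℕ → R) {N a : ℕ} (f : ℕ → R) (ha : a < N) :
    tailSum w N f a = w a * f a + tailSum w N f (a + 1) :=
  Finset.sum_eq_sum_Ico_succ_bot ha _

theorem tailSum_self (w : ℕ → R) (N : ℕ) (f : ℕ → R) : tailSum w N f N = 0 := by
  simp [tailSum]

theorem tailSum_iterate_congr {w : ℕ → R} {N : ℕ} {f g : ℕ → R} (hfg : ∀ n < N, f n = g n)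
    (j : ℕ) {a : ℕ} (ha : a < N) : (tailSum w N)^[j] f a = (tailSum w N)^[j] g a := by
  induction j generalizing a with
  | zero => exact hfg a ha
  | succ j ih =>
    simp only [Function.iterate_succ_apply', tailSum]
    exact Finset.sum_congr rfl fun n hn => by rw [ih (Finset.mem_Ico.mp hn).2]

theorem blockNested_congr {w u : ℕ → R} {N : ℕ} {f g : ℕ → R} (hfg : ∀ n < N, f n = g n)
    (k : Index) {a : ℕ} (ha : a < N) : blockNested w u N f k a = blockNested w u N g k a := by
  induction k generalizing a with
  | nil => exact hfg a ha
  | cons c k ih =>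
    refine Finset.sum_congr rfl fun n hn => ?_
    rw [tailSum_iterate_congr (fun n hn => ih hn) _ (Finset.mem_Ioo.mp hn).2]

theorem tailSum_iterate_mul (w : ℕ → R) (N : ℕ) (c : R) (f : ℕ → R) (j : ℕ) :
    (tailSum w N)^[j] (fun n => c * f n) = fun n => c * (tailSum w N)^[j] f n := by
  induction j with
  | zero => rfl
  | succ j ih =>
    funext a
    simp only [Function.iterate_succ_apply', ih, tailSum, Finset.mul_sum]
    exact Finset.sum_congr rfl fun n _ => by ring

theorem blockNested_neg (w u : ℕ → R) (N : ℕ) (f : ℕ → R) (k : Index) (a : ℕ) :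
    blockNested w (fun n => -u n) N f k a = (-1) ^ k.length * blockNested w u N f k a := by
  induction k generalizing a with
  | nil => simp [blockNested]
  | cons c k ih =>
    simp only [blockNested, funext ih, tailSum_iterate_mul, Finset.mul_sum, List.length_cons]
    exact Finset.sum_congr rfl fun n _ => by ring

end Nested

/-! ### The connected sum -/

section Connector

variable {R : Type*} [CommRing R]

/-- The connector `m (m - 1) ⋯ (m - n + 1) * (u 1 ⋯ u n)`. -/
def connector (u : ℕ → R) (n m : ℕ) : R :=
  (m.descFactorial n : R) * ∏ j ∈ Finset.range n, u (j + 1)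

theorem connector_zero_left (u : ℕ → R) (m : ℕ) : connector u 0 m = 1 := by
  simp [connector]

theorem connector_eq_zero (u : ℕ → R) {n m : ℕ} (h : m < n) : connector u n m = 0 := by
  simp [connector, Nat.descFactorial_eq_zero_iff_lt.mpr h]

theorem connector_succ_left (u : ℕ → R) (n m : ℕ) :
    connector u (n + 1) m = ((m : R) - n) * u (n + 1) * connector u n m := by
  rcases le_or_gt n m with h | h
  · rw [connector, connector, Nat.descFactorial_succ, Finset.prod_range_succ]
    push_cast [h]
    ring
  · rw [connector_eq_zero u h, connector_eq_zero u (h.trans n.lt_succ_self), mul_zero]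

theorem connector_succ_succ (u : ℕ → R) (n m : ℕ) :
    connector u (n + 1) (m + 1) = ((m : R) + 1) * u (n + 1) * connector u n m := by
  rw [connector, connector, Nat.succ_descFactorial_succ, Finset.prod_range_succ]
  push_cast
  ring

/-- The pairing of the difference sequence of `s` with the connector. -/
def pairing (u : ℕ → R) (N : ℕ) (s : ℕ → R) (n : ℕ) : R :=
  ∑ m ∈ Finset.range N, (s m - s (m + 1)) * connector u n m

theorem pairing_zero (u : ℕ → R) {N : ℕ} {s : ℕ → R} (hs : s N = 0) :
    pairing u N s 0 = s 0 := by
  simp only [pairing, connector_zero_left, mul_one, Finset.sum_range_sub', hs, sub_zero]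

/-- Abel summation, used to move the difference from s to the connector. -/
theorem sum_range_sub_mul (s f : ℕ → R) (M : ℕ) :
    ∑ m ∈ Finset.range (M + 1), (s m - s (m + 1)) * f m =
      s 0 * f 0 - s (M + 1) * f M + ∑ m ∈ Finset.range M, s (m + 1) * (f (m + 1) - f m) := by
  induction M with
  | zero => simp; ring
  | succ M ih =>
    rw [Finset.sum_range_succ, ih, Finset.sum_range_succ _ M]
    ring

variable {w u : ℕ → R} {x : R} {N : ℕ}

theorem connector_sub_right (hw : ∀ n, 0 < n → n < N → (n : R) * w n = 1) (n : ℕ) {m : ℕ}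
    (hm : m + 1 < N) :
    connector u (n + 1) (m + 1) - connector u (n + 1) m =
      ((n : R) + 1) * (w (m + 1) * connector u (n + 1) (m + 1)) := by
  have h := hw (m + 1) m.succ_pos hm
  push_cast at h
  rw [connector_succ_succ, connector_succ_left]
  linear_combination (-(n + 1 : R) * u (n + 1) * connector u n m) * h

/-- After clearing denominators this is (x - (m+1)) = (x - (n+1)) - (m - n). The right side is a
difference in n, so summing over n will telescope. -/
theorem mul_connector_succ_succ (hw : ∀ n, 0 < n → n < N → (n : R) * w n = 1)
    (hu : ∀ n, 0 < n → n < N → (x - n) * u n = 1) {n m : ℕ} (hn : n + 1 < N) (hm : m + 1 < N) :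
    w (m + 1) * connector u (n + 1) (m + 1) =
      u (m + 1) * (connector u n m - connector u (n + 1) m) := by
  have h := hw (m + 1) m.succ_pos hm
  have hn' := hu (n + 1) n.succ_pos hn
  have hm' := hu (m + 1) m.succ_pos hm
  push_cast at h hn' hm'
  rw [connector_succ_succ, connector_succ_left]
  linear_combination (u (n + 1) * connector u n m) * h +
    (u (m + 1) * connector u n m) * hn' - (u (n + 1) * connector u n m) * hm'

theorem mul_pairing (hw : ∀ n, 0 < n → n < N → (n : R) * w n = 1) {s : ℕ → R} (hs : s N = 0)
    {n : ℕ} (hn : 0 < n) (hnN : n < N) :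
    w n * pairing u N s n =
      ∑ m ∈ Finset.range (N - 1), s (m + 1) * (w (m + 1) * connector u n (m + 1)) := by
  obtain ⟨M, rfl⟩ : ∃ M, N = M + 1 := ⟨N - 1, by omega⟩
  obtain ⟨n, rfl⟩ : ∃ n', n = n' + 1 := ⟨n - 1, by omega⟩
  rw [pairing, sum_range_sub_mul, hs, connector_eq_zero u n.succ_pos, Nat.add_sub_cancel]
  simp only [mul_zero, zero_mul, sub_zero, zero_add, Finset.mul_sum]
  refine Finset.sum_congr rfl fun m hm => ?_
  rw [connector_sub_right hw n (by simpa using hm)]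
  have h := hw (n + 1) hn hnN
  push_cast at h
  linear_combination (s (m + 1) * w (m + 1) * connector u (n + 1) (m + 1)) * h

/-- The differences of the tail sum of s are `w m * s m`, which are the coefficients left by Abel
summation. The term m = 0 drops out because C(n, 0) = 0 for n > 0. -/
theorem mul_pairing_eq_pairing_tailSum (hw : ∀ n, 0 < n → n < N → (n : R) * w n = 1)
    {s : ℕ → R} (hs : s N = 0) {n : ℕ} (hn : 0 < n) (hnN : n < N) :
    w n * pairing u N s n = pairing u N (tailSum w N s) n := by
  rw [mul_pairing hw hs hn hnN, pairing]
  obtain ⟨M, rfl⟩ : ∃ M, N = M + 1 := ⟨N - 1, by omega⟩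
  rw [Finset.sum_range_succ', connector_eq_zero u hn, mul_zero, add_zero, Nat.add_sub_cancel]
  refine Finset.sum_congr rfl fun m hm => ?_
  rw [tailSum_of_lt w s (by simpa using hm)]
  ring

theorem pow_mul_pairing (hw : ∀ n, 0 < n → n < N → (n : R) * w n = 1)
    {s : ℕ → R} (hs : s N = 0) {n : ℕ} (hn : 0 < n) (hnN : n < N) (j : ℕ) :
    w n ^ j * pairing u N s n = pairing u N ((tailSum w N)^[j] s) n := by
  induction j generalizing s with
  | zero => simp
  | succ j ih =>
    rw [pow_succ, mul_assoc, mul_pairing_eq_pairing_tailSum hw hs hn hnN, ih (tailSum_self w N s),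
      Function.iterate_succ_apply]

theorem sum_mul_pairing (hw : ∀ n, 0 < n → n < N → (n : R) * w n = 1)
    (hu : ∀ n, 0 < n → n < N → (x - n) * u n = 1) {s : ℕ → R} (hs : s N = 0) {a : ℕ}
    (ha : a < N) :
    ∑ n ∈ Finset.Ioo a N, w n * pairing u N s n =
      pairing u N (fun b => ∑ n ∈ Finset.Ioo b N, u n * s n) a := by
  obtain ⟨M, rfl⟩ : ∃ M, N = M + 1 := ⟨N - 1, by omega⟩
  have hI : Finset.Ioo a (M + 1) = Finset.Ico (a + 1) (M + 1) := by
    ext; simp only [Finset.mem_Ioo, Finset.mem_Ico]; omega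
  have h1 : ∑ n ∈ Finset.Ioo a (M + 1), w n * pairing u (M + 1) s n =
      ∑ n ∈ Finset.Ioo a (M + 1), ∑ m ∈ Finset.range M,
        s (m + 1) * (w (m + 1) * connector u n (m + 1)) := by
    refine Finset.sum_congr rfl fun n hn => ?_
    obtain ⟨hn1, hn2⟩ := Finset.mem_Ioo.mp hn
    exact mul_pairing hw hs (by omega) hn2
  rw [h1, Finset.sum_comm, pairing, Finset.sum_range_succ]
  have hM : Finset.Ioo M (M + 1) = ∅ := by ext; simp
  have hM' : Finset.Ioo (M + 1) (M + 1) = ∅ := by simp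
  rw [hM, hM', sub_self, zero_mul, add_zero]
  refine Finset.sum_congr rfl fun m hm => ?_
  have hmM : m < M := Finset.mem_range.mp hm
  have h2 : Finset.Ioo m (M + 1) = insert (m + 1) (Finset.Ioo (m + 1) (M + 1)) := by
    ext; simp only [Finset.mem_Ioo, Finset.mem_insert]; omega
  rw [h2, Finset.sum_insert (by simp), add_sub_cancel_right, ← Finset.mul_sum, hI,
    ← Finset.sum_Ico_add' _ a M 1]
  have h3 : ∀ n ∈ Finset.Ico a M, w (m + 1) * connector u (n + 1) (m + 1) =
      u (m + 1) * (connector u n m - connector u (n + 1) m) := fun n hn =>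
    mul_connector_succ_succ hw hu (by have := Finset.mem_Ico.mp hn; omega) (by omega)
  -- Telescoping in n; the far end C(M, m) vanishes because m < M.
  have h4 : ∑ n ∈ Finset.Ico a M, (connector u n m - connector u (n + 1) m) =
      connector u a m := by
    have := Finset.sum_Ico_sub (fun n => connector u n m) (show a ≤ M by omega)
    simp only [connector_eq_zero u hmM] at this
    rw [← neg_inj, ← Finset.sum_neg_distrib]
    simpa using this
  rw [Finset.sum_congr rfl h3, ← Finset.mul_sum, h4]
  ring

theorem blockNested_self_eq_zero {s : ℕ → R} (hs : s N = 0) (k : Index) :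
    blockNested w u N s k N = 0 := by
  cases k <;> simp [blockNested, hs]

theorem tailSum_iterate_self {s : ℕ → R} (hs : s N = 0) (j : ℕ) :
    (tailSum w N)^[j] s N = 0 := by
  cases j with
  | zero => exact hs
  | succ j => rw [Function.iterate_succ_apply', tailSum_self]

theorem nested_pairing (hw : ∀ n, 0 < n → n < N → (n : R) * w n = 1)
    (hu : ∀ n, 0 < n → n < N → (x - n) * u n = 1) {s : ℕ → R} (hs : s N = 0) (k : Index)
    {a : ℕ} (ha : a < N) :
    nested w N (pairing u N s) k a = pairing u N (blockNested w u N s k) a := by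
  induction k generalizing a with
  | nil => rfl
  | cons c k ih =>
    have h0 := blockNested_self_eq_zero (w := w) (u := u) hs k
    have h1 : ∀ n ∈ Finset.Ioo a N, w n ^ (c : ℕ) * nested w N (pairing u N s) k n =
        w n * pairing u N ((tailSum w N)^[(c : ℕ) - 1] (blockNested w u N s k)) n := by
      intro n hn
      obtain ⟨hn1, hn2⟩ := Finset.mem_Ioo.mp hn
      -- Of the c factors `w n`, c - 1 become tail sums; the remaining one is consumed in
      -- transporting the sum over n.
      rw [ih hn2, ← pow_mul_pairing hw h0 (by omega) hn2, ← mul_assoc, ← pow_succ',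
        Nat.sub_add_cancel c.pos]
    rw [nested, Finset.sum_congr rfl h1, sum_mul_pairing hw hu (tailSum_iterate_self h0 _) ha]
    rfl

/-- The duality between nested sums weighted by the connector and block-wise nested sums. -/
theorem nested_connector (hw : ∀ n, 0 < n → n < N → (n : R) * w n = 1)
    (hu : ∀ n, 0 < n → n < N → (x - n) * u n = 1) (hN : 0 < N) (k : Index) :
    nested w N (fun n => connector u n (N - 1)) k 0 = blockNested w u N 1 k 0 := by
  -- The only nonzero difference of this cutoff is at m = N - 1, so its pairing is the connector
  -- there; it also satisfies s N = 0, unlike the constant 1.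
  set s : ℕ → R := fun n => if n < N then 1 else 0
  have hs : s N = 0 := by simp [s]
  have h1 : (fun n => connector u n (N - 1)) = pairing u N s := by
    funext n
    obtain ⟨M, rfl⟩ : ∃ M, N = M + 1 := ⟨N - 1, by omega⟩
    rw [pairing, Finset.sum_range_succ, Finset.sum_eq_zero]
    · simp [s]
    · intro m hm
      have := Finset.mem_range.mp hm
      simp [s, this, this.le]
  rw [h1, nested_pairing hw hu hs k hN, pairing_zero u (blockNested_self_eq_zero hs k)]
  exact blockNested_congr (fun n hn => by simp [s, hn]) k hN

end Connector

/-! ### Coarsenings and blocks -/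

/-- The weight, i.e. the sum of the entries, of an index. -/
def weight (k : Index) : ℕ := (k.map fun a : ℕ+ => (a : ℕ)).sum

@[simp] theorem weight_nil : weight [] = 0 := rfl

@[simp] theorem weight_cons (a : ℕ+) (k : Index) : weight (a :: k) = a + weight k := by
  simp [weight]

theorem weight_eq_zero {k : Index} (h : weight k = 0) : k = [] := by
  cases k with
  | nil => rfl
  | cons a k => have := a.pos; simp at h

theorem Coarser.weight_eq {h k : Index} (H : Coarser h k) : weight h = weight k := by
  induction H with
  | nil => rfl
  | keep a _ ih => simp [ih]
  | plus a b _ ih => simp [ih, add_assoc]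

theorem Coarser.refl (k : Index) : Coarser k k := by
  induction k with
  | nil => exact Coarser.nil
  | cons a k ih => exact Coarser.keep a ih

theorem Coarser.append {h k h' k' : Index} (H : Coarser h k) (H' : Coarser h' k') :
    Coarser (h ++ h') (k ++ k') := by
  induction H with
  | nil => exact H'
  | keep a _ ih => exact Coarser.keep a ih
  | plus a b _ ih => exact Coarser.plus a b ih

theorem coarser_singleton {s : ℕ+} {h : Index} (hw : weight h = s) : Coarser [s] h := by
  induction hn : h.length generalizing h with
  | zero =>
    rw [List.length_eq_zero_iff.mp hn] at hw
    exact absurd hw.symm s.ne_zero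
  | succ n ih =>
    match h, hn with
    | [a], _ =>
      have : a = s := PNat.eq (by simpa using hw)
      rw [this]
      exact Coarser.refl _
    | a :: b :: h, hn =>
      exact Coarser.plus a b (ih (by simpa [add_assoc] using hw) (by simpa using hn))

theorem Coarser.exists_append_of_cons {s : ℕ+} {o h : Index} (H : Coarser (s :: o) h) :
    ∃ h₁ h₂, h = h₁ ++ h₂ ∧ weight h₁ = s ∧ Coarser o h₂ := by
  generalize hk : s :: o = k at H
  induction H with
  | nil => simp at hk
  | @keep a h k H ih =>
    obtain ⟨rfl, rfl⟩ := List.cons.inj hk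
    exact ⟨[s], k, rfl, by simp, H⟩
  | @plus a b h k H ih =>
    obtain ⟨h₁, h₂, e, hw, H'⟩ := ih hk
    cases h₁ with
    | nil => exact absurd hw.symm s.ne_zero
    | cons c h₁ =>
      obtain ⟨rfl, rfl⟩ := List.cons.inj e
      exact ⟨a :: b :: h₁, h₂, rfl, by simpa [add_assoc] using hw, H'⟩

theorem Coarser.le_of_cons {c a : ℕ+} {h k : Index} (H : Coarser (c :: h) (a :: k)) : a ≤ c := by
  generalize hk : a :: k = k' at H
  generalize hh : c :: h = h' at H
  induction H generalizing a k with
  | nil => simp at hk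
  | keep b H ih =>
    rw [(List.cons.inj hk).1, (List.cons.inj hh).1]
  | plus b d H ih =>
    rw [(List.cons.inj hk).1]
    exact le_trans (PNat.lt_add_right b d).le (ih rfl hh)

/-- Equal weights on the left force the comma at the cut to be kept, so the merging happens
separately on each side. -/
theorem Coarser.of_append {h₁ h₂ k₁ k₂ : Index} (H : Coarser (h₁ ++ h₂) (k₁ ++ k₂))
    (hw : weight h₁ = weight k₁) : Coarser h₁ k₁ ∧ Coarser h₂ k₂ := by
  generalize hh : h₁ ++ h₂ = h at H
  generalize hk : k₁ ++ k₂ = k at H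
  induction H generalizing h₁ h₂ k₁ k₂ with
  | nil =>
    obtain ⟨rfl, rfl⟩ := List.append_eq_nil_iff.mp hh
    obtain ⟨rfl, rfl⟩ := List.append_eq_nil_iff.mp hk
    exact ⟨.nil, .nil⟩
  | @keep a h k H ih =>
    cases k₁ with
    | nil =>
      obtain rfl := weight_eq_zero hw
      simp only [List.nil_append] at hh hk
      exact ⟨.nil, hh ▸ hk ▸ H.keep a⟩
    | cons b k₁ =>
      cases h₁ with
      | nil =>
        have := b.pos
        simp only [weight_nil, weight_cons] at hw
        omega
      | cons c h₁ =>
        simp only [List.cons_append, List.cons.injEq] at hh hk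
        obtain ⟨rfl, hh⟩ := hh
        obtain ⟨rfl, hk⟩ := hk
        obtain ⟨H₁, H₂⟩ := ih (by simpa using hw) hh hk
        exact ⟨H₁.keep _, H₂⟩
  | @plus a b h k H ih =>
    match k₁, hk with
    | [], hk =>
      obtain rfl := weight_eq_zero hw
      simp only [List.nil_append] at hh hk
      exact ⟨.nil, hh ▸ hk ▸ H.plus a b⟩
    | [c], hk =>
      cases h₁ with
      | nil =>
        have := c.pos
        simp only [weight_nil, weight_cons] at hw
        omega
      | cons d h₁ =>
        obtain ⟨rfl, hk⟩ := List.cons.inj hk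
        -- Here the comma at the cut would be merged: the head of h₁ is then at least c + b, more
        -- than the whole weight c of h₁.
        rw [← hh] at H
        have h1 : (c : ℕ) + b ≤ d := by
          have := H.le_of_cons
          rw [← PNat.coe_le_coe] at this
          simpa using this
        have := b.pos
        simp at hw
        omega
    | c :: d :: k₁, hk =>
      simp only [List.cons_append, List.cons.injEq] at hk
      obtain ⟨rfl, rfl, rfl⟩ := hk
      obtain ⟨H₁, H₂⟩ := ih (k₁ := (c + d) :: k₁) (by simpa [add_assoc] using hw) hh rfl
      exact ⟨H₁.plus _ _, H₂⟩

theorem append_inj_of_weight_eq {h₁ h₂ k₁ k₂ : Index} (H : h₁ ++ h₂ = k₁ ++ k₂)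
    (hw : weight h₁ = weight k₁) : h₁ = k₁ ∧ h₂ = k₂ := by
  induction h₁ generalizing k₁ with
  | nil =>
    obtain rfl := weight_eq_zero hw.symm
    exact ⟨rfl, H⟩
  | cons a h₁ ih =>
    cases k₁ with
    | nil => simp at hw
    | cons b k₁ =>
      simp only [List.cons_append, List.cons.injEq] at H
      obtain ⟨rfl, H⟩ := H
      obtain ⟨rfl, rfl⟩ := ih H (by simpa using hw)
      exact ⟨rfl, rfl⟩

/-- The block `(i + 1, {1}^{c - 1})`. -/
def block (i : ℕ) (c : ℕ+) : Index := i.succPNat :: List.replicate ((c : ℕ) - 1) 1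

theorem weight_block (i : ℕ) (c : ℕ+) : weight (block i c) = i + c := by
  have : weight (List.replicate ((c : ℕ) - 1) 1) = (c : ℕ) - 1 := by simp [weight]
  have := c.pos
  simp only [block, weight_cons, Nat.succPNat_coe]
  omega

theorem oplus_cons (c : ℕ+) (k : Index) (i : ℕ) (l : Fin k.length → ℕ) :
    oplus (c :: k) (Fin.cons i l) = ⟨i + (c : ℕ), Nat.add_pos_right _ c.pos⟩ :: oplus k l := by
  unfold oplus
  exact List.ofFn_succ

theorem oslash_cons (c : ℕ+) (k : Index) (i : ℕ) (l : Fin k.length → ℕ) :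
    oslash (c :: k) (Fin.cons i l) = block i c ++ oslash k l := by
  unfold oslash
  erw [List.ofFn_succ]
  rfl

theorem mem_between {k : Index} {l : Fin k.length → ℕ} {h : Index} :
    h ∈ between k l ↔ Coarser h (oslash k l) ∧ Coarser (oplus k l) h := by
  simp [between, mem_coarsenings]

theorem mem_between_cons {c : ℕ+} {k : Index} {i : ℕ} {l : Fin k.length → ℕ} {h : Index} :
    h ∈ between (c :: k) (Fin.cons i l : Fin (k.length + 1) → ℕ) ↔
      ∃ h₁ ∈ coarsenings (block i c), ∃ h₂ ∈ between k l, h₁ ++ h₂ = h := by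
  simp only [mem_between, mem_coarsenings]
  rw [oplus_cons, oslash_cons]
  constructor
  · rintro ⟨H, H'⟩
    obtain ⟨h₁, h₂, rfl, hw, H₂⟩ := H'.exists_append_of_cons
    obtain ⟨H₁, H₃⟩ := H.of_append (by rw [hw, weight_block]; rfl)
    exact ⟨h₁, H₁, h₂, ⟨H₃, H₂⟩, rfl⟩
  · rintro ⟨h₁, H₁, h₂, ⟨H₂, H₃⟩, rfl⟩
    refine ⟨H₁.append H₂, ?_⟩
    exact (coarser_singleton (by rw [H₁.weight_eq, weight_block]; rfl)).append H₃

/-- The first entry of l ⊕ k has the weight of the first block of l ⊘ k, so every h in between has a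
cut there. The cut is unique, since all coarsenings of the block share its weight. -/
theorem sum_between_cons {M : Type*} [AddCommMonoid M] (F : Index → M) (c : ℕ+) (k : Index)
    (i : ℕ) (l : Fin k.length → ℕ) :
    ∑ h ∈ between (c :: k) (Fin.cons i l : Fin (k.length + 1) → ℕ), F h =
      ∑ h₁ ∈ coarsenings (block i c), ∑ h₂ ∈ between k l, F (h₁ ++ h₂) := by
  rw [← Finset.sum_product']
  refine (Finset.sum_nbij (fun q : Index × Index => q.1 ++ q.2) ?_ ?_ ?_ fun _ _ => rfl).symm
  · intro q hq
    obtain ⟨h1, h2⟩ := Finset.mem_product.mp hq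
    exact mem_between_cons.mpr ⟨_, h1, _, h2, rfl⟩
  · intro q hq r hr e
    obtain ⟨h1, -⟩ := Finset.mem_product.mp hq
    obtain ⟨h2, -⟩ := Finset.mem_product.mp hr
    obtain ⟨e1, e2⟩ := append_inj_of_weight_eq e (by
      rw [(mem_coarsenings.mp h1).weight_eq, (mem_coarsenings.mp h2).weight_eq])
    exact Prod.ext e1 e2
  · intro h hh
    obtain ⟨h₁, H₁, h₂, H₂, rfl⟩ := mem_between_cons.mp hh
    exact ⟨(h₁, h₂), Finset.mem_coe.mpr (Finset.mem_product.mpr ⟨H₁, H₂⟩), rfl⟩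

theorem sum_antidiagonalTuple_succ {M : Type*} [AddCommMonoid M] (r m : ℕ)
    (F : (Fin (r + 1) → ℕ) → M) :
    ∑ l ∈ Finset.Nat.antidiagonalTuple (r + 1) m, F l =
      ∑ q ∈ Finset.HasAntidiagonal.antidiagonal m, ∑ l ∈ Finset.Nat.antidiagonalTuple r q.2,
        F (Fin.cons q.1 l) := by
  rw [Finset.sum_sigma']
  symm
  refine Finset.sum_nbij' (fun q : (_ : ℕ × ℕ) × (Fin r → ℕ) => Fin.cons q.1.1 q.2)
    (fun l : Fin (r + 1) → ℕ => ⟨(l 0, ∑ i, Fin.tail l i), Fin.tail l⟩) ?_ ?_ ?_ ?_ fun _ _ => rfl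
  · rintro ⟨q, l⟩ hq
    simp only [Finset.mem_sigma, Finset.HasAntidiagonal.mem_antidiagonal, Finset.Nat.mem_antidiagonalTuple] at hq ⊢
    rw [Fin.sum_univ_succ]
    simp [hq.2, hq.1]
  · intro l hl
    simp only [Finset.mem_sigma, Finset.HasAntidiagonal.mem_antidiagonal, Finset.Nat.mem_antidiagonalTuple] at hl ⊢
    rw [Fin.sum_univ_succ] at hl
    exact ⟨hl, trivial⟩
  · rintro ⟨⟨i, j⟩, l⟩ hq
    simp only [Finset.mem_sigma, Finset.HasAntidiagonal.mem_antidiagonal, Finset.Nat.mem_antidiagonalTuple] at hq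
    simp [hq.2]
  · intro l _
    simp

/-! ### Sums over coarsenings as weak tail sums -/

section Sums

variable {R : Type*} [CommRing R]

theorem sum_coarsenings_cons_cons {M : Type*} [AddCommMonoid M] (F : Index → M) (a b : ℕ+)
    (k : Index) :
    ∑ h ∈ coarsenings (a :: b :: k), F h =
      ∑ h ∈ coarsenings (b :: k), F (a :: h) + ∑ h ∈ coarsenings ((a + b) :: k), F h := by
  rw [coarsenings, Finset.sum_union, Finset.sum_image]
  · intro x _ y _ e
    exact (List.cons.inj e).2
  · rw [Finset.disjoint_left]
    intro h h1 h2
    obtain ⟨h', -, rfl⟩ := Finset.mem_image.mp h1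
    exact absurd (mem_coarsenings.mp h2).le_of_cons (not_le.mpr (PNat.lt_add_right a b))

/-- A kept comma means a strict inequality between neighbouring variables and a plus sign means
equality, so together they give ≤. -/
theorem sum_coarsenings_nested (w : ℕ → R) (N : ℕ) (f : ℕ → R) (c : ℕ+) (j a : ℕ) :
    ∑ h ∈ coarsenings (c :: List.replicate j 1), nested w N f h a =
      ∑ n ∈ Finset.Ioo a N, w n ^ (c : ℕ) * (tailSum w N)^[j] f n := by
  induction j generalizing c a with
  | zero => simp [coarsenings, nested]
  | succ j ih =>
    rw [List.replicate_succ, sum_coarsenings_cons_cons, ih]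
    simp only [nested]
    rw [Finset.sum_comm, ← Finset.sum_add_distrib]
    refine Finset.sum_congr rfl fun n hn => ?_
    rw [← Finset.mul_sum, ih, Function.iterate_succ_apply', tailSum,
      ← Finset.Ioo_insert_left (Finset.mem_Ioo.mp hn).2, Finset.sum_insert (by simp)]
    simp only [PNat.add_coe, PNat.one_coe, pow_succ, pow_zero, one_mul]
    ring

theorem coeff_tailSum_iterate (w : ℕ → R) (N : ℕ) (g : ℕ → PowerSeries R) (j m n : ℕ) :
    PowerSeries.coeff m ((tailSum (fun n => PowerSeries.C (w n)) N)^[j] g n) =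
      (tailSum w N)^[j] (fun b => PowerSeries.coeff m (g b)) n := by
  induction j generalizing n with
  | zero => rfl
  | succ j ih => simp [Function.iterate_succ_apply', tailSum, ih]

theorem coeff_nested (w : ℕ → R) (N : ℕ) (g : ℕ → PowerSeries R) (k : Index) (m n : ℕ) :
    PowerSeries.coeff m (nested (fun n => PowerSeries.C (w n)) N g k n) =
      nested w N (fun b => PowerSeries.coeff m (g b)) k n := by
  induction k generalizing n with
  | nil => rfl
  | cons c k ih => simp [nested, ← map_pow, ih]

/-- The coefficients of the block-wise nested sum with `u n = w n / (1 - w n * X)`. -/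
theorem coeff_blockNested (w : ℕ → R) (N : ℕ) (k : Index) (m a : ℕ) :
    PowerSeries.coeff m (blockNested (fun n => PowerSeries.C (w n))
        (fun n => PowerSeries.mk fun i => w n ^ (i + 1)) N 1 k a) =
      ∑ l ∈ Finset.Nat.antidiagonalTuple k.length m, ∑ h ∈ between k l, nested w N 1 h a := by
  induction k generalizing m a with
  | nil =>
    cases m with
    | zero =>
      have : between [] ![] = {[]} := by
        ext h
        rw [mem_between, Finset.mem_singleton]
        constructor
        · rintro ⟨H, -⟩
          exact weight_eq_zero H.weight_eq
        · rintro rfl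
          exact ⟨.nil, .nil⟩
      simp [blockNested, nested, this]
    | succ m => simp [blockNested, PowerSeries.coeff_one]
  | cons c k ih =>
    simp only [blockNested, map_sum, PowerSeries.coeff_mul, PowerSeries.coeff_mk,
      coeff_tailSum_iterate, ih]
    rw [Finset.sum_comm]
    refine Eq.trans ?_ (sum_antidiagonalTuple_succ k.length m _).symm
    refine Finset.sum_congr rfl fun q _ => ?_
    refine Eq.trans ?_ (Finset.sum_congr rfl fun l _ => (sum_between_cons _ c k q.1 l).symm)
    rw [Finset.sum_comm]
    simp only [nested_append]
    refine ((sum_coarsenings_nested w N _ q.1.succPNat ((c : ℕ) - 1) a).symm.trans ?_)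
    refine Finset.sum_congr rfl fun h _ => ?_
    rw [nested_sum]
    exact Finset.sum_congr rfl fun l _ => nested_sum _ _ _ _ _ _

end Sums

/-! ### Truncated values and the harmonic product -/

theorem sum_strictMono_eq_nested (N : ℕ) (k : Index) (a : ℕ) :
    ∑ n ∈ Fintype.piFinset (fun _ : Fin k.length => Finset.Ioo a N) with
      (∀ i j : Fin k.length, i < j → n i < n j),
      ∏ i : Fin k.length, 1 / (n i : ℚ) ^ (k.get i : ℕ) =
    nested (fun n => (n : ℚ)⁻¹) N 1 k a := by
  induction k generalizing a with
  | nil =>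
    rw [Finset.filter_true_of_mem]
    · simp [nested]
    · intro n _ i
      exact i.elim0
  | cons c k ih =>
    simp only [nested, ← ih, Finset.mul_sum]
    rw [Finset.sum_sigma']
    symm
    refine Finset.sum_nbij'
      (fun q : (_ : ℕ) × (Fin k.length → ℕ) => (Fin.cons q.1 q.2 : Fin (k.length + 1) → ℕ))
      (fun n : Fin (k.length + 1) → ℕ => ⟨n 0, Fin.tail n⟩) ?_ ?_ ?_ ?_ ?_
    · rintro ⟨m, n⟩ hq
      simp only [Finset.mem_sigma, Finset.mem_filter, Fintype.mem_piFinset, Finset.mem_Ioo] at hq ⊢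
      obtain ⟨hm, hn, hlt⟩ := hq
      constructor
      · intro i
        refine Fin.cases ?_ (fun i => ?_) i
        · simpa using hm
        · have := hn i
          simp only [Fin.cons_succ]
          omega
      · intro i j
        refine Fin.cases ?_ (fun j => ?_) j
        · exact fun h => absurd h (Fin.not_lt_zero _)
        · refine Fin.cases (fun _ => ?_) (fun i h => ?_) i
          · simpa using (hn j).1
          · simpa using hlt i j (Fin.succ_lt_succ_iff.mp h)
    · intro n hn
      simp only [Finset.mem_sigma, Finset.mem_filter, Fintype.mem_piFinset, Finset.mem_Ioo] at hn ⊢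
      obtain ⟨hn, hlt⟩ := hn
      exact ⟨hn 0, fun i => ⟨hlt 0 i.succ (Fin.succ_pos i), (hn i.succ).2⟩,
        fun i j h => hlt i.succ j.succ (Fin.succ_lt_succ_iff.mpr h)⟩
    · rintro ⟨m, n⟩ _
      simp
    · intro n _
      exact Fin.cons_self_tail n
    · rintro ⟨m, n⟩ _
      refine Eq.trans ?_ (Fin.prod_univ_succ _).symm
      simp

theorem zetaLT_eq_nested (N : ℕ) (k : Index) :
    zetaLT N k = nested (fun n => (n : ℚ)⁻¹) N 1 k 0 :=
  sum_strictMono_eq_nested N k 0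

theorem zetaLT_nil (N : ℕ) : zetaLT N [] = 1 := by
  rw [zetaLT_eq_nested]; rfl

theorem zetaLT_concat (N : ℕ) (k : Index) (a : ℕ+) :
    zetaLT N (k ++ [a]) = ∑ n ∈ Finset.Ioo 0 N, (n : ℚ)⁻¹ ^ (a : ℕ) * zetaLT n k := by
  rw [zetaLT_eq_nested, nested_concat]
  simp [zetaLT_eq_nested]

/-- The `ℚ`-linear extension of `ζ_{<N}` to `ℛ`. -/
noncomputable def zetaLTLin (N : ℕ) : IndexSpace →ₗ[ℚ] ℚ := Finsupp.linearCombination ℚ (zetaLT N)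

@[simp] theorem zetaLTLin_single (N : ℕ) (k : Index) : zetaLTLin N (single k) = zetaLT N k := by
  simp [zetaLTLin, single]

@[simp] theorem snoc_single (a : ℕ+) (k : Index) : snoc a (single k) = single (k ++ [a]) := by
  simp [snoc, single]

theorem zetaLTLin_snoc (N : ℕ) (a : ℕ+) (x : IndexSpace) :
    zetaLTLin N (snoc a x) = ∑ n ∈ Finset.Ioo 0 N, (n : ℚ)⁻¹ ^ (a : ℕ) * zetaLTLin n x := by
  induction x using Finsupp.induction_linear with
  | zero => simp
  | add x y hx hy => simp only [map_add, hx, hy, mul_add, Finset.sum_add_distrib]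
  | single k c =>
    have : Finsupp.single k c = c • single k := by simp [single]
    rw [this]
    simp only [map_smul, snoc_single, zetaLTLin_single, zetaLT_concat, smul_eq_mul,
      Finset.mul_sum]
    exact Finset.sum_congr rfl fun n _ => by ring

theorem sum_Ioo_zero_succ {M : Type*} [AddCommMonoid M] (f : ℕ → M) (N : ℕ) (hN : 0 < N) :
    ∑ n ∈ Finset.Ioo 0 (N + 1), f n = ∑ n ∈ Finset.Ioo 0 N, f n + f N := by
  have : Finset.Ioo 0 (N + 1) = insert N (Finset.Ioo 0 N) := by
    ext; simp only [Finset.mem_Ioo, Finset.mem_insert]; omega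
  rw [this, Finset.sum_insert (by simp), add_comm]

theorem sum_Ioo_mul_sum_Ioo {R : Type*} [CommRing R] (f g : ℕ → R) (N : ℕ) :
    (∑ n ∈ Finset.Ioo 0 N, f n) * ∑ n ∈ Finset.Ioo 0 N, g n =
      ∑ n ∈ Finset.Ioo 0 N, f n * ∑ m ∈ Finset.Ioo 0 n, g m +
        ∑ n ∈ Finset.Ioo 0 N, g n * ∑ m ∈ Finset.Ioo 0 n, f m +
          ∑ n ∈ Finset.Ioo 0 N, f n * g n := by
  induction N with
  | zero => simp
  | succ N ih =>
    rcases N.eq_zero_or_pos with rfl | hN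
    · have : Finset.Ioo 0 (0 + 1) = ∅ := rfl
      simp [this]
    · simp only [sum_Ioo_zero_succ _ N hN]
      linear_combination ih

theorem zetaLTLin_harmonicAux (N : ℕ) (k l : Index) :
    zetaLTLin N (harmonicAux k l) = zetaLT N k.reverse * zetaLT N l.reverse := by
  induction k, l using harmonicAux.induct generalizing N with
  | case1 l => simp [harmonicAux, zetaLT_nil]
  | case2 a k => simp [harmonicAux, zetaLT_nil]
  | case3 a k b l ih1 ih2 ih3 =>
    rw [harmonicAux]
    simp only [map_add, zetaLTLin_snoc, ih1, ih2, ih3, List.reverse_cons, zetaLT_concat]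
    rw [sum_Ioo_mul_sum_Ioo]
    refine congr_arg₂ _ (congr_arg₂ _ ?_ ?_) ?_
    · exact Finset.sum_congr rfl fun n _ => by ring
    · exact Finset.sum_congr rfl fun n _ => by ring
    · exact Finset.sum_congr rfl fun n _ => by rw [PNat.add_coe]; ring

theorem zetaLTLin_harmonic (N : ℕ) (k l : Index) :
    zetaLTLin N (harmonic k l) = zetaLT N k * zetaLT N l := by
  simp [harmonic, zetaLTLin_harmonicAux]

theorem zetaLT_succ_concat {N : ℕ} (hN : 0 < N) (k : Index) (a : ℕ+) :
    zetaLT (N + 1) (k ++ [a]) = zetaLT N (k ++ [a]) + (N : ℚ)⁻¹ ^ (a : ℕ) * zetaLT N k := by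
  rw [zetaLT_concat, zetaLT_concat, sum_Ioo_zero_succ _ N hN]

/-- The product ∗̲ keeps those stuffle terms whose largest variable belongs to k, possibly shared
with h. The variables of h thus run up to and including that variable, whence n + 1. -/
theorem zetaLTLin_underIndex (N : ℕ) (k h : Index) :
    zetaLTLin N (underIndex k h) =
      nested (fun n => (n : ℚ)⁻¹) N (fun n => zetaLT (n + 1) h) k 0 := by
  rcases List.eq_nil_or_concat h with rfl | ⟨h, b, rfl⟩
  · simp only [underIndex, dif_pos, zetaLTLin_single, zetaLT_eq_nested]
    rfl
  rcases List.eq_nil_or_concat k with rfl | ⟨k, a, rfl⟩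
  -- For empty k the function is evaluated at 0, and ζ_{<1} of a nonempty index is an empty sum;
  -- this matches ∅ ∗̲ l = 0.
  · have : Finset.Ioo 0 (0 + 1) = ∅ := rfl
    simp [underIndex, nested, zetaLT_concat, this]
  · simp only [List.concat_eq_append]
    rw [nested_concat, underIndex, dif_neg (by simp), dif_neg (by simp)]
    simp only [List.getLast_append_singleton, List.dropLast_concat, map_add, zetaLTLin_snoc,
      zetaLTLin_harmonic]
    rw [← Finset.sum_add_distrib]
    refine Finset.sum_congr rfl fun n hn => ?_
    rw [zetaLT_succ_concat (Finset.mem_Ioo.mp hn).1, ← zetaLT_eq_nested n k, PNat.add_coe]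
    ring

/-! ### Reduction modulo `p` -/

/-- The rational number `q` is integral at `p` and its residue class is `z`. -/
def ReducesTo (p : Nat.Primes) (q : ℚ) (z : ZMod p) : Prop :=
  (q.den : ZMod p) ≠ 0 ∧ (q : ZMod p) = z

namespace ReducesTo

variable {p : Nat.Primes}

theorem one : ReducesTo p 1 1 := by simp [ReducesTo]

theorem zero : ReducesTo p 0 0 := by simp [ReducesTo]

theorem add {q r : ℚ} {y z : ZMod p} (hq : ReducesTo p q y) (hr : ReducesTo p r z) :
    ReducesTo p (q + r) (y + z) := by
  refine ⟨?_, by rw [Rat.cast_add_of_ne_zero hq.1 hr.1, hq.2, hr.2]⟩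
  obtain ⟨c, hc⟩ := Rat.add_den_dvd q r
  intro h
  have := congr_arg (Nat.cast : ℕ → ZMod p) hc
  push_cast at this
  rw [h, zero_mul] at this
  exact mul_ne_zero hq.1 hr.1 this

theorem mul {q r : ℚ} {y z : ZMod p} (hq : ReducesTo p q y) (hr : ReducesTo p r z) :
    ReducesTo p (q * r) (y * z) := by
  refine ⟨?_, by rw [Rat.cast_mul_of_ne_zero hq.1 hr.1, hq.2, hr.2]⟩
  obtain ⟨c, hc⟩ := Rat.mul_den_dvd q r
  intro h
  have := congr_arg (Nat.cast : ℕ → ZMod p) hc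
  push_cast at this
  rw [h, zero_mul] at this
  exact mul_ne_zero hq.1 hr.1 this

theorem pow {q : ℚ} {y : ZMod p} (hq : ReducesTo p q y) (n : ℕ) : ReducesTo p (q ^ n) (y ^ n) := by
  induction n with
  | zero => simpa using one
  | succ n ih => simpa [pow_succ] using ih.mul hq

theorem sum {ι : Type*} {s : Finset ι} {f : ι → ℚ} {g : ι → ZMod p}
    (h : ∀ i ∈ s, ReducesTo p (f i) (g i)) : ReducesTo p (∑ i ∈ s, f i) (∑ i ∈ s, g i) := by
  induction s using Finset.cons_induction with
  | empty => simpa using zero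
  | cons i s hi ih =>
    rw [Finset.sum_cons, Finset.sum_cons]
    exact (h i (Finset.mem_cons_self i s)).add
      (ih fun j hj => h j (Finset.mem_cons_of_mem hj))

theorem natCast_ne_zero {n : ℕ} (hn : 0 < n) (hnp : n < p) : (n : ZMod p) ≠ 0 := by
  rw [Ne, ZMod.natCast_eq_zero_iff]
  exact Nat.not_dvd_of_pos_of_lt hn hnp

theorem natCast_inv {n : ℕ} (hn : 0 < n) (hnp : n < p) :
    ReducesTo p (n : ℚ)⁻¹ (n : ZMod p)⁻¹ := by
  have h := natCast_ne_zero hn hnp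
  refine ⟨?_, by simp⟩
  rwa [Rat.inv_natCast_den_of_pos hn]

theorem nested {N : ℕ} (hN : N ≤ p) {f : ℕ → ℚ} {g : ℕ → ZMod p}
    (h : ∀ n < N, ReducesTo p (f n) (g n)) (k : Index) {a : ℕ} (ha : a < N) :
    ReducesTo p (nested (fun n => (n : ℚ)⁻¹) N f k a)
      (FMZV.nested (fun n => (n : ZMod p)⁻¹) N g k a) := by
  induction k generalizing a with
  | nil => exact h a ha
  | cons c k ih =>
    refine sum fun n hn => ?_
    obtain ⟨hn1, hn2⟩ := Finset.mem_Ioo.mp hn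
    exact ((natCast_inv (by omega) (by omega)).pow _).mul (ih hn2)

theorem zetaLT {N : ℕ} (hN0 : 0 < N) (hN : N ≤ p) (k : Index) :
    ReducesTo p (zetaLT N k) (FMZV.nested (fun n => (n : ZMod p)⁻¹) N 1 k 0) := by
  rw [zetaLT_eq_nested]
  exact nested hN (fun _ _ => one) k hN0

end ReducesTo

/-- The formal sums of indices with coefficients in `ℕ`. -/
noncomputable def natSpan : AddSubmonoid IndexSpace := AddSubmonoid.closure (Set.range single)

theorem single_mem_natSpan (k : Index) : single k ∈ natSpan :=
  AddSubmonoid.subset_closure ⟨k, rfl⟩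

theorem snoc_mem_natSpan (a : ℕ+) {x : IndexSpace} (hx : x ∈ natSpan) : snoc a x ∈ natSpan := by
  induction hx using AddSubmonoid.closure_induction with
  | mem x h =>
    obtain ⟨k, rfl⟩ := h
    rw [snoc_single]
    exact single_mem_natSpan _
  | zero => simp [natSpan.zero_mem]
  | add x y _ _ hx hy =>
    rw [map_add]
    exact natSpan.add_mem hx hy

theorem harmonicAux_mem_natSpan (k l : Index) : harmonicAux k l ∈ natSpan := by
  induction k, l using harmonicAux.induct with
  | case1 l =>
    rw [harmonicAux]
    exact single_mem_natSpan _
  | case2 a k =>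
    rw [harmonicAux]
    exact single_mem_natSpan _
  | case3 a k b l ih1 ih2 ih3 =>
    rw [harmonicAux]
    exact natSpan.add_mem (natSpan.add_mem (snoc_mem_natSpan a ih1) (snoc_mem_natSpan b ih2))
      (snoc_mem_natSpan _ ih3)

theorem underIndex_mem_natSpan (k l : Index) : underIndex k l ∈ natSpan := by
  rw [underIndex]
  split_ifs
  · exact single_mem_natSpan k
  · exact natSpan.zero_mem
  · exact natSpan.add_mem (snoc_mem_natSpan _ (harmonicAux_mem_natSpan _ _))
      (snoc_mem_natSpan _ (harmonicAux_mem_natSpan _ _))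

/-- The cast from ℚ to ℤ/p is additive only on p-integral numbers. Natural coefficients preserve
integrality at every p, so no finite set of primes has to be discarded. -/
theorem zetaALin_eq_mk {x : IndexSpace} (hx : x ∈ natSpan) :
    (∀ p : Nat.Primes, ((zetaLTLin p x).den : ZMod p) ≠ 0) ∧
      zetaALin x =
        Ideal.Quotient.mk sumIdeal fun p : Nat.Primes => ((zetaLTLin p x : ℚ) : ZMod p) := by
  induction hx using AddSubmonoid.closure_induction with
  | mem x h =>
    obtain ⟨k, rfl⟩ := h
    refine ⟨fun p => ?_, by simp [zetaALin, zetaA, single, zetaLTLin]⟩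
    rw [zetaLTLin_single]
    exact (ReducesTo.zetaLT p.2.pos le_rfl k).1
  | zero =>
    refine ⟨fun p => by simp, ?_⟩
    simp only [map_zero, Rat.cast_zero]
    exact (map_zero (Ideal.Quotient.mk sumIdeal)).symm
  | add x y _ _ hx hy =>
    refine ⟨fun p => ?_, ?_⟩
    · rw [map_add]
      exact (ReducesTo.add ⟨hx.1 p, rfl⟩ ⟨hy.1 p, rfl⟩).1
    · rw [map_add, hx.2, hy.2, ← map_add]
      congr 1
      funext p
      rw [map_add, Rat.cast_add_of_ne_zero (hx.1 p) (hy.1 p)]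
      rfl

/-! ### The generating function -/

section GeneratingFunction

open PowerSeries

variable {R : Type*} [CommRing R]

theorem mk_pow_succ_mul (c : R) :
    (PowerSeries.mk fun i => c ^ (i + 1)) * (1 - C c * X) = C c := by
  ext m
  rw [mul_sub, mul_one, map_sub, ← mul_assoc]
  cases m with
  | zero => simp
  | succ m => simp [coeff_succ_mul_X, pow_succ]

/-- Iterated tail sums of 1 are the complete homogeneous symmetric polynomials in `w a, …, w (N -
1)`. Lowering a by one contributes one geometric factor. -/
theorem mk_tailSum_mul (w : ℕ → R) (N : ℕ) {a : ℕ} (ha : a ≤ N) :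
    (PowerSeries.mk fun m => (tailSum w N)^[m] 1 a) *
      ∏ j ∈ Finset.Ico a N, (1 - C (w j) * X) = 1 := by
  induction ha using Nat.decreasingInduction with
  | self =>
    ext m
    cases m with
    | zero => simp
    | succ m => simp [Function.iterate_succ_apply', tailSum_self, coeff_one]
  | of_succ a ha ih =>
    rw [Finset.prod_eq_prod_Ico_succ_bot (show a < N from ha), ← mul_assoc]
    convert ih using 2
    ext m
    rw [mul_sub, mul_one, map_sub, ← mul_assoc]
    cases m with
    | zero => simp
    | succ m =>
      simp only [coeff_mk, coeff_succ_mul_X, coeff_mul_C, Function.iterate_succ_apply']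
      rw [tailSum_of_lt w _ (show a < N from ha)]
      ring

theorem sum_coarsenings_replicate (w : ℕ → R) (n m : ℕ) :
    ∑ h ∈ coarsenings (List.replicate m 1), nested w (n + 1) 1 h 0 =
      (tailSum w (n + 1))^[m] 1 1 := by
  cases m with
  | zero => simp [coarsenings, nested]
  | succ m =>
    rw [List.replicate_succ, sum_coarsenings_nested, Function.iterate_succ_apply', tailSum]
    simp only [PNat.one_coe, pow_one]
    rfl

theorem connector_mul_prod {w : ℕ → R} {u : ℕ → PowerSeries R} {N : ℕ}
    (hN : ((N + 1 : ℕ) : R) = 0) (hw : ∀ n, 0 < n → n ≤ N → (n : R) * w n = 1)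
    (hu : ∀ n, u n * (1 - C (w n) * X) = -C (w n)) {n : ℕ} (hn : n ≤ N) :
    connector u n N * ∏ j ∈ Finset.range n, (1 - C (w (j + 1)) * X) = 1 := by
  induction n with
  | zero => simp [connector_zero_left]
  | succ n ih =>
    rw [connector_succ_left, Finset.prod_range_succ]
    have h1 := congr_arg (C (R := R)) hN
    have h2 := congr_arg (C (R := R)) (hw (n + 1) n.succ_pos hn)
    have h3 := ih (Nat.le_of_succ_le hn)
    have h4 := hu (n + 1)
    simp only [Nat.cast_add, Nat.cast_one, map_add, map_mul, map_one, map_zero, map_natCast] at h1 h2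
    -- The new factor is (N - n) * (-w (n + 1)); as N = -1 it equals (n + 1) * w (n + 1) = 1.
    linear_combination ((N : PowerSeries R) - n) *
      (connector u n N * ∏ j ∈ Finset.range n, (1 - C (w (j + 1)) * X)) * h4 -
      ((N : PowerSeries R) - n) * C (w (n + 1)) * h3 - C (w (n + 1)) * h1 + h2

theorem coeff_connector {w : ℕ → R} {u : ℕ → PowerSeries R} {N : ℕ}
    (hN : ((N + 1 : ℕ) : R) = 0) (hw : ∀ n, 0 < n → n ≤ N → (n : R) * w n = 1)
    (hu : ∀ n, u n * (1 - C (w n) * X) = -C (w n)) {n : ℕ} (hn : n ≤ N) (m : ℕ) :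
    coeff m (connector u n N) =
      ∑ h ∈ coarsenings (List.replicate m 1), nested w (n + 1) 1 h 0 := by
  have h1 := connector_mul_prod hN hw hu hn
  have h2 := mk_tailSum_mul w (n + 1) (show 1 ≤ n + 1 by omega)
  rw [Finset.prod_Ico_eq_prod_range, Nat.add_sub_cancel] at h2
  simp only [add_comm 1] at h2
  rw [sum_coarsenings_replicate]
  -- Both series are inverse to the same product.
  have h3 : connector u n N = PowerSeries.mk fun m => (tailSum w (n + 1))^[m] 1 1 := by
    linear_combination (PowerSeries.mk fun m => (tailSum w (n + 1))^[m] 1 1) * h1 -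
      connector u n N * h2
  rw [h3, coeff_mk]

/-- The duality, in any ring in which `N + 1` vanishes and `1, …, N` are invertible. -/
theorem sum_nested_eq {w : ℕ → R} {N : ℕ} (hN : ((N + 1 : ℕ) : R) = 0)
    (hw : ∀ n, 0 < n → n ≤ N → (n : R) * w n = 1) (k : Index) (m : ℕ) :
    ∑ h ∈ coarsenings (List.replicate m 1),
        nested w (N + 1) (fun n => nested w (n + 1) 1 h 0) k 0 =
      (-1) ^ k.length * ∑ l ∈ Finset.Nat.antidiagonalTuple k.length m,
        ∑ h ∈ between k l, nested w (N + 1) 1 h 0 := by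
  set v : ℕ → PowerSeries R := fun n => PowerSeries.mk fun i => w n ^ (i + 1)
  have hv : ∀ n, v n * (1 - C (w n) * X) = C (w n) := fun n => mk_pow_succ_mul (w n)
  have hu : ∀ n, -v n * (1 - C (w n) * X) = -C (w n) := fun n => by rw [neg_mul, hv]
  have hw' : ∀ n, 0 < n → n < N + 1 → (n : PowerSeries R) * C (w n) = 1 := fun n h0 hn => by
    have := congr_arg (C (R := R)) (hw n h0 (by omega))
    simpa using this
  -- The parameter x is the power series variable, and -v n is the expansion of 1/(X - n).
  have hx : ∀ n, 0 < n → n < N + 1 → (X - (n : PowerSeries R)) * -v n = 1 := fun n h0 hn => by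
    linear_combination (v n * X) * hw' n h0 hn + (n : PowerSeries R) * hv n + hw' n h0 hn
  have key := congr_arg (coeff m) (nested_connector hw' hx N.succ_pos k)
  rw [blockNested_neg, coeff_nested] at key
  have hs : ((-1 : PowerSeries R) ^ k.length) = C ((-1) ^ k.length) := by simp
  rw [hs, coeff_C_mul, coeff_blockNested] at key
  rw [← key, ← nested_sum]
  refine nested_congr (fun n hn => ?_) k N.succ_pos
  rw [Nat.add_sub_cancel, coeff_connector hN hw hu (by omega)]

end GeneratingFunction

/-! ### Specialisation to the primes and conclusion -/

theorem reducesTo_sum_underIndex (p : Nat.Primes) (k : Index) (m : ℕ) :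
    ReducesTo p (zetaLTLin p (∑ h ∈ coarsenings (List.replicate m 1), underIndex k h))
      ((-1) ^ k.length * ∑ l ∈ Finset.Nat.antidiagonalTuple k.length m,
        ∑ h ∈ between k l, nested (fun n => (n : ZMod p)⁻¹) p 1 h 0) := by
  obtain ⟨N, hN⟩ : ∃ N, (p : ℕ) = N + 1 := ⟨p - 1, by have := p.2.pos; omega⟩
  have h := sum_nested_eq (w := fun n => (n : ZMod p)⁻¹) (N := N)
    (by rw [← hN]; exact CharP.cast_eq_zero (ZMod p) p)
    (fun n h0 hn => mul_inv_cancel₀ (ReducesTo.natCast_ne_zero h0 (by omega))) k m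
  rw [← hN] at h
  rw [← h, map_sum]
  refine ReducesTo.sum fun h _ => ?_
  rw [zetaLTLin_underIndex]
  exact ReducesTo.nested le_rfl (fun n hn => ReducesTo.zetaLT n.succ_pos hn h) k p.2.pos

theorem under_single_star (k l : Index) :
    under (single k) (star l) = ∑ h ∈ coarsenings l, underIndex k h := by
  simp [under, single, star]

end FMZV

theorem mainTheorem9 (k : FMZV.Index) (m : ℕ) :
    FMZV.zetaALin (FMZV.under (FMZV.single k) (FMZV.star (List.replicate m 1))) =
      (-1 : FMZV.RingA) ^ k.length *
        ∑ l ∈ Finset.Nat.antidiagonalTuple k.length m,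
          ∑ h ∈ FMZV.between k l, FMZV.zetaA h := by
  rw [FMZV.under_single_star, (FMZV.zetaALin_eq_mk (FMZV.natSpan.sum_mem fun h _ =>
    FMZV.underIndex_mem_natSpan k h)).2]
  simp only [FMZV.zetaA, ← map_sum]
  rw [← map_one (Ideal.Quotient.mk FMZV.sumIdeal), ← map_neg, ← map_pow, ← map_mul]
  congr 1
  -- The chosen representatives agree at each prime, not just modulo the direct sum.
  funext p
  rw [(FMZV.reducesTo_sum_underIndex p k m).2]
  simp only [Pi.mul_apply, Pi.pow_apply, Pi.neg_apply, Pi.one_apply, Finset.sum_apply,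
    (FMZV.ReducesTo.zetaLT p.2.pos le_rfl _).2]
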